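/- Let $r\ge 1$ and let $e_1,\dots,e_{r+1}$ be the standard basis of $\mathbb{R}^{r+1}$. For the Lie algebra $\mathfrak{sl}_{r+1}(\mathbb{C})$ of type $A_r$, let $\alpha_k=e_k-e_{k+1}$ ($1\le k\le r$) be the simple roots, put $\alpha_{i,j}=\alpha_i+\alpha_{i+1}+\cdots+\alpha_j$ for $1\le i\le j\le r$, and let $\Phi^+=\{\alpha_{i,j}:1\le i\le j\le r\}$ be the set of positive roots, $\tilde\alpha=\alpha_1+\cdots+\alpha_r$ the highest root, and $\rho=\tfrac12\sum_{\alpha\in\Phi^+}\alpha$. Let $W$ be the Weyl group, generated by the reflections $s_1,\dots,s_r$ of $\mathbb{R}^{r+1}$ through the hyperplanes orthogonal to $\alpha_1,\dots,\alpha_r$. Let $\wp(\xi)$ denote Kostant's partition function, i.e. the number of ways to write $\xi$ as a linear combination of the positive roots with nonnegative integer coefficients. For weights $\lambda,\mu$ the Weyl alternation set in rank $r$ is $$\mathcal{A}_r(\lambda,\mu)=\{\sigma\in W : \wp(\sigma(\lambda+\rho)-\mu-\rho)>0\}.$$ **Proposition.** Let $r\ge 3$ and $1\le i\le j\le r-2$.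 If $\mu=-\alpha_{i,j}$, then $$|\mathcal{A}_r(\tilde\alpha,\mu)|=|\mathcal{A}_{r-1}(\tilde\alpha,\mu)|+|\mathcal{A}_{r-2}(\tilde\alpha,\mu)|,$$ where in each term $\tilde\alpha$ is the highest root of the Lie algebra of the indicated rank, and $\mu=-(\alpha_i+\cdots+\alpha_j)$ is formed from the simple roots of that rank. -/

import Mathlib

/-!
Weyl alternation sets for the Lie algebra `sl_{r+1}(ℂ)` (type `A_r`), in the standard realisation of
its root system in the Euclidean space `ℝ^{r+1}`.
-/

namespace TypeA

noncomputable section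

/-- The ambient Euclidean space `ℝ^{r+1}` of the root system of type `A_r`. -/
abbrev Space (r : ℕ) : Type := EuclideanSpace ℝ (Fin (r + 1))

/-- The simple root `α_{k+1} = e_{k+1} - e_{k+2}` of type `A_r`; the index `k : Fin r` starts at `0`,
the names `α_1, …, α_r` start at `1`. -/
def simpleRoot (r : ℕ) (k : Fin r) : Space r :=
  EuclideanSpace.single k.castSucc 1 - EuclideanSpace.single k.succ 1

/-- `α_{i,j} = α_i + α_{i+1} + ⋯ + α_j` in rank `r`, for `1 ≤ i ≤ j ≤ r` (indices start at `1`). -/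
def rootSum (r i j : ℕ) : Space r :=
  ∑ k : Fin r with i ≤ k.val + 1 ∧ k.val + 1 ≤ j, simpleRoot r k

/-- The set `Φ⁺ = {α_{i,j} : 1 ≤ i ≤ j ≤ r}` of positive roots. -/
def posRoots (r : ℕ) : Finset (Space r) :=
  open Classical in
  ((Finset.Icc 1 r ×ˢ Finset.Icc 1 r).filter fun p => p.1 ≤ p.2).image fun p => rootSum r p.1 p.2

/-- The highest root `α_1 + α_2 + ⋯ + α_r`. -/
def highestRoot (r : ℕ) : Space r := ∑ k : Fin r, simpleRoot r k

/-- `ρ`, half the sum of the positive roots. -/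
def rho (r : ℕ) : Space r := (1 / 2 : ℝ) • ∑ β ∈ posRoots r, β

/-- The reflection `s_{k+1}` through the hyperplane orthogonal to `α_{k+1}`. -/
def simpleReflection (r : ℕ) (k : Fin r) : Space r ≃ₗᵢ[ℝ] Space r :=
  (Submodule.span ℝ {simpleRoot r k})ᗮ.reflection

/-- The Weyl group, generated by the simple reflections. -/
def weylGroup (r : ℕ) : Subgroup (Space r ≃ₗᵢ[ℝ] Space r) :=
  Subgroup.closure (Set.range (simpleReflection r))

/-- The ways to write `ξ` as a linear combination of positive roots with nonnegative integer
coefficients. -/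
def vectorPartitions (r : ℕ) (ξ : Space r) : Set (posRoots r → ℕ) :=
  {c | ∑ β : posRoots r, c β • (β : Space r) = ξ}

/-- Kostant's partition function: the number of ways to write `ξ` as a linear combination of positive
roots with nonnegative integer coefficients (a finite number, see `vectorPartitions_finite`). -/
def kostant (r : ℕ) (ξ : Space r) : ℕ := (vectorPartitions r ξ).ncard

/-- The Weyl alternation set `A_r(lam, mu) = {σ ∈ W | ℘(σ(lam + ρ) - mu - ρ) > 0}`. -/
def alternationSet (r : ℕ) (lam mu : Space r) : Set (weylGroup r) :=
  {σ | 0 < kostant r ((σ : Space r ≃ₗᵢ[ℝ] Space r) (lam + rho r) - mu - rho r)}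

/-! ### The sets counted above are finite -/

/-- A linear functional that is equal to `1` on every simple root. -/
def height (r : ℕ) : Space r →ₗ[ℝ] ℝ where
  toFun v := ∑ k : Fin (r + 1), -(k.val : ℝ) * v k
  map_add' v w := by simp [mul_add, Finset.sum_add_distrib]
  map_smul' c v := by
    simp only [PiLp.smul_apply, smul_eq_mul, RingHom.id_apply, Finset.mul_sum]
    exact Finset.sum_congr rfl fun _ _ => by ring

theorem height_simpleRoot (r : ℕ) (k : Fin r) : height r (simpleRoot r k) = 1 := by
  simp [height, simpleRoot, mul_sub, Finset.sum_sub_distrib]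

theorem one_le_height (r : ℕ) {β : Space r} (hβ : β ∈ posRoots r) : 1 ≤ height r β := by
  classical
  simp only [posRoots, Finset.mem_image, Finset.mem_filter, Finset.mem_product,
    Finset.mem_Icc] at hβ
  obtain ⟨⟨i, j⟩, ⟨⟨⟨hi, hi'⟩, -⟩, hij⟩, rfl⟩ := hβ
  simp only [rootSum, map_sum, height_simpleRoot, Finset.sum_const, nsmul_eq_mul, mul_one]
  have : 0 < (Finset.univ.filter fun k : Fin r => i ≤ k.val + 1 ∧ k.val + 1 ≤ j).card := by
    refine Finset.card_pos.2 ⟨⟨i - 1, by omega⟩, ?_⟩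
    simp only [Finset.mem_filter, Finset.mem_univ, true_and]
    simp only at hi hij
    omega
  exact_mod_cast this

theorem vectorPartitions_finite (r : ℕ) (ξ : Space r) : (vectorPartitions r ξ).Finite := by
  refine (Set.finite_Iic (fun _ : posRoots r => ⌊height r ξ⌋₊)).subset ?_
  intro c hc β
  have hc' : ∑ β : posRoots r, c β • (β : Space r) = ξ := hc
  have h : ∑ γ : posRoots r, (c γ : ℝ) * height r γ = height r ξ := by
    rw [← hc', map_sum]
    exact Finset.sum_congr rfl fun γ _ => by rw [map_nsmul, nsmul_eq_mul]
  have h0 : ∀ γ : posRoots r, (c γ : ℝ) ≤ (c γ : ℝ) * height r γ := fun γ =>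
    le_mul_of_one_le_right (Nat.cast_nonneg _) (one_le_height r γ.2)
  refine Nat.le_floor ((h0 β).trans (h ▸ ?_))
  exact Finset.single_le_sum (f := fun γ : posRoots r => (c γ : ℝ) * height r γ)
    (fun γ _ => (Nat.cast_nonneg _).trans (h0 γ)) (Finset.mem_univ β)

/-- Simple reflections act as adjacent transpositions of the coordinates. -/
theorem simpleReflection_apply (r : ℕ) (k : Fin r) (v : Space r) (m : Fin (r + 1)) :
    simpleReflection r k v m = v (Equiv.swap k.castSucc k.succ m) := by
  have hne : k.castSucc ≠ k.succ := Fin.castSucc_lt_succ.ne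
  have hin : ∀ w : Space r, inner ℝ (simpleRoot r k) w = w k.castSucc - w k.succ := fun w => by
    rw [simpleRoot, inner_sub_left, EuclideanSpace.inner_single_left,
      EuclideanSpace.inner_single_left]
    simp
  have hn : ‖simpleRoot r k‖ ^ 2 = 2 := by
    rw [← real_inner_self_eq_norm_sq, hin]
    simp [simpleRoot, hne, hne.symm]
    norm_num
  have key : simpleReflection r k v = v - (v k.castSucc - v k.succ) • simpleRoot r k := by
    rw [simpleReflection, Submodule.reflection_orthogonal_apply,
      Submodule.reflection_singleton_apply, hin]
    simp only [RCLike.ofReal_real_eq_id, id, hn]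
    module
  rw [key]
  by_cases h1 : m = k.castSucc
  · subst h1; simp [simpleRoot, hne]
  · by_cases h2 : m = k.succ
    · subst h2; simp [simpleRoot, hne.symm]
    · rw [Equiv.swap_apply_of_ne_of_ne h1 h2]; simp [simpleRoot, h1, h2]

theorem exists_perm_of_mem_weylGroup (r : ℕ) {σ : Space r ≃ₗᵢ[ℝ] Space r} (hσ : σ ∈ weylGroup r) :
    ∃ p : Equiv.Perm (Fin (r + 1)), ∀ (v : Space r) (m : Fin (r + 1)), σ v m = v (p m) := by
  induction hσ using Subgroup.closure_induction with
  | mem x hx =>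
    obtain ⟨k, rfl⟩ := hx
    exact ⟨_, simpleReflection_apply r k⟩
  | one => exact ⟨1, fun _ _ => rfl⟩
  | mul x y _ _ hx hy =>
    obtain ⟨p, hp⟩ := hx
    obtain ⟨q, hq⟩ := hy
    exact ⟨q * p, fun v m => by
      rw [LinearIsometryEquiv.coe_mul, Function.comp_apply, hp, hq, Equiv.Perm.mul_apply]⟩
  | inv x _ hx =>
    obtain ⟨p, hp⟩ := hx
    refine ⟨p⁻¹, fun v m => ?_⟩
    have h := hp (x⁻¹ v) (p⁻¹ m)
    have hxx : x (x⁻¹ v) = v := x.apply_symm_apply v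
    rw [hxx] at h
    simpa using h.symm

instance weylGroup_finite (r : ℕ) : Finite (weylGroup r) := by
  choose f hf using fun σ : weylGroup r => exists_perm_of_mem_weylGroup r σ.2
  refine Finite.of_injective f fun σ τ h => Subtype.ext (LinearIsometryEquiv.ext fun v => ?_)
  ext m
  rw [hf, hf, h]

end

end TypeA

namespace TypeA

/-! Expanding a vector of coordinate sum zero in simple roots gives its partial coordinate sums as
coefficients, so `℘ > 0` means that these sums are nonnegative integers. With the Weyl group acting
as the permutations of `{0, …, r}`, the alternation set becomes `altPerms`, a set cut out by
inequalities on partial sums of `shiftCoord`.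

If `p` preserves `{0, …, n}` and `j < n`, the `μ` terms cancel and the `n`-th partial sum depends
only on `p n` (`sum_shiftCoord`). The last inequality thus forces `p r = r`, and the one before it
leaves `p (r - 1) = r - 1` or `p (r - 1) = r - 2`. The first case is exactly rank `r - 1`
(`altPerms_fixing_eq`). In the second, composing with the transposition of the values `r - 2` and `r
- 1` gives exactly rank `r - 2` (`altPerms_swapping_eq`). Extending permutations to `ℕ` by the
identity puts all ranks in one group, so the recursion is a disjoint union there. -/

/-! ### Permutations and partial sums -/

/-- The `m`-th coordinate of `σ(α̃ + ρ) - μ - ρ` for `μ = -α_{i,j}`, where `σ` permutes the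
coordinates by `p`. -/
def shiftCoord (r i j : ℕ) (p : Equiv.Perm ℕ) (m : ℕ) : ℤ :=
  (m : ℤ) - p m + (if p m = 0 then 1 else 0) - (if p m = r then 1 else 0) +
    ((if m + 1 = i then 1 else 0) - (if m = j then 1 else 0))

/-- The permutations of `{0, …, r}`, extended by the identity to `ℕ`, that correspond to the
elements of `A_r(α̃, -α_{i,j})`. -/
def altPerms (r i j : ℕ) : Set (Equiv.Perm ℕ) :=
  {p | (∀ m, r < m → p m = m) ∧
    ∀ k, 1 ≤ k → k ≤ r → 0 ≤ ∑ m ∈ Finset.range k, shiftCoord r i j p m}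

theorem lt_of_fixes {n : ℕ} {p : Equiv.Perm ℕ} (hp : ∀ m, n ≤ m → p m = m) {m : ℕ}
    (hm : m < n) : p m < n := by
  by_contra h
  have h1 := hp (p m) (by omega)
  have h2 := p.injective h1
  omega

theorem sum_range_apply {n : ℕ} {p : Equiv.Perm ℕ} (hp : ∀ m, n ≤ m → p m = m)
    (f : ℕ → ℤ) : ∑ m ∈ Finset.range n, f (p m) = ∑ m ∈ Finset.range n, f m := by
  refine Equiv.Perm.sum_comp p (Finset.range n) f fun m hm => ?_
  by_contra h
  exact hm (hp m (by simpa using h))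

theorem sum_range_ite {R : Type*} [Ring R] (a n : ℕ) :
    ∑ m ∈ Finset.range n, (if m = a then (1 : R) else 0) = if a < n then 1 else 0 := by
  simp [Finset.sum_ite_eq']

theorem sum_range_ite_succ {R : Type*} [Ring R] {a n : ℕ} (ha : 1 ≤ a) :
    ∑ m ∈ Finset.range n, (if m + 1 = a then (1 : R) else 0) = if a ≤ n then 1 else 0 := by
  obtain ⟨b, rfl⟩ : ∃ b, a = b + 1 := ⟨a - 1, by omega⟩
  simp only [Nat.add_right_cancel_iff, sum_range_ite]
  rfl

/-- The partial sum up to the last coordinate in a block that is preserved by `p`. -/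
theorem sum_shiftCoord {r i j n : ℕ} {p : Equiv.Perm ℕ} (hp : ∀ m, n < m → p m = m)
    (hi : 1 ≤ i) (hin : i ≤ n) (hjn : j < n) (hnr : n ≤ r) :
    ∑ m ∈ Finset.range n, shiftCoord r i j p m =
      (p n : ℤ) - n + (if p n = 0 then 0 else 1) -
        (if n = r then (if p n = n then 0 else 1) else 0) := by
  -- The images of `0, …, n - 1` are all of `{0, …, n}` except `p n`.
  have key : ∀ f : ℕ → ℤ, ∑ m ∈ Finset.range n, f (p m) =
      ∑ m ∈ Finset.range (n + 1), f m - f (p n) := fun f => by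
    rw [← sum_range_apply (p := p) (n := n + 1) (fun m hm => hp m (by omega)) f,
      Finset.sum_range_succ]
    ring
  simp only [shiftCoord, Finset.sum_add_distrib, Finset.sum_sub_distrib, sum_range_ite,
    sum_range_ite_succ hi, key (fun m => (m : ℤ)), key (fun m => if m = 0 then 1 else 0),
    key (fun m => if m = r then 1 else 0)]
  rw [Finset.sum_range_succ]
  have := lt_of_fixes (n := n + 1) (p := p) (fun m hm => hp m (by omega)) (m := n) (by omega)
  split_ifs <;> omega

/-! ### The recursion for `altPerms` -/

theorem apply_last_of_mem {r i j : ℕ} {p : Equiv.Perm ℕ} (hi : 1 ≤ i) (hir : i ≤ r)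
    (hjr : j < r) (hp : p ∈ altPerms r i j) : p r = r := by
  have h := hp.2 r (by omega) le_rfl
  rw [sum_shiftCoord hp.1 hi hir hjr le_rfl] at h
  have := lt_of_fixes (n := r + 1) (p := p) (fun m hm => hp.1 m (by omega)) (m := r) (by omega)
  split_ifs at h <;> omega

/-- The two ranks differ only in which value carries the `-1` of the highest root, `s + 1` or `s`.
Neither value is taken on `{0, …, s - 1}`, since `p` fixes both. -/
theorem mem_altPerms_succ_iff {s i j : ℕ} {p : Equiv.Perm ℕ} (hi : 1 ≤ i) (hij : i ≤ j)
    (hjs : j ≤ s) (hp : ∀ m, s < m → p m = m) (hps : p s = s) :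
    p ∈ altPerms (s + 1) i j ↔ ∀ k, 1 ≤ k → k ≤ s →
      0 ≤ ∑ m ∈ Finset.range k, shiftCoord s i j p m := by
  have hp' : ∀ m, s ≤ m → p m = m := fun m hm => by
    rcases hm.eq_or_lt with rfl | h
    exacts [hps, hp m h]
  have hsum : ∀ k, k ≤ s → ∑ m ∈ Finset.range k, shiftCoord (s + 1) i j p m =
      ∑ m ∈ Finset.range k, shiftCoord s i j p m := fun k hk => by
    refine Finset.sum_congr rfl fun m hm => ?_
    have := lt_of_fixes hp' (m := m) (by have := Finset.mem_range.1 hm; omega)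
    simp only [shiftCoord]
    split_ifs <;> omega
  constructor
  · intro h k h1 h2
    rw [← hsum k h2]
    exact h.2 k h1 (by omega)
  · intro h
    refine ⟨fun m hm => hp m (by omega), fun k h1 h2 => ?_⟩
    rcases h2.eq_or_lt with rfl | h2
    -- The one inequality absent from rank `s` reads `0 ≤ 0`.
    · rw [sum_shiftCoord (fun m hm => hp m (by omega)) hi (by omega) (by omega) le_rfl,
        hp (s + 1) (by omega)]
      simp
    · rw [hsum k (by omega)]
      exact h k h1 (by omega)

theorem altPerms_fixing_eq {s i j : ℕ} (hi : 1 ≤ i) (hij : i ≤ j) (hjs : j < s) :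
    {p ∈ altPerms (s + 1) i j | p s = s} = altPerms s i j := by
  ext p
  constructor
  · rintro ⟨h, hps⟩
    have hp : ∀ m, s < m → p m = m := fun m hm => by
      rcases (Nat.succ_le_of_lt hm).eq_or_lt with rfl | h'
      exacts [apply_last_of_mem hi (by omega) (by omega) h, h.1 m h']
    exact ⟨hp, (mem_altPerms_succ_iff hi hij hjs.le hp hps).1 h⟩
  · intro h
    have hps := apply_last_of_mem hi (by omega) hjs h
    exact ⟨(mem_altPerms_succ_iff hi hij hjs.le h.1 hps).2 h.2, hps⟩

theorem apply_penultimate_of_mem {t i j : ℕ} {p : Equiv.Perm ℕ} (hi : 1 ≤ i) (hij : i ≤ j)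
    (hjt : j ≤ t) (hp : p ∈ altPerms (t + 2) i j) : p (t + 1) = t + 1 ∨ p (t + 1) = t := by
  have hl := apply_last_of_mem hi (by omega) (by omega) hp
  have hp' : ∀ m, t + 1 < m → p m = m := fun m hm => by
    rcases (Nat.succ_le_of_lt hm).eq_or_lt with rfl | h'
    exacts [hl, hp.1 m h']
  have h := hp.2 (t + 1) (by omega) (by omega)
  rw [sum_shiftCoord hp' hi (by omega) (by omega) (by omega)] at h
  have := lt_of_fixes (n := t + 2) (p := p) hp' (m := t + 1) (by omega)
  split_ifs at h <;> omega

/-- Where `p m = t`, raising the value to `t + 1` lowers the coordinate by one, which replaces the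
`-1` that the highest root of rank `t` contributes at `t`. Since `1 ≤ t`, the value `0` is
untouched. -/
theorem shiftCoord_swap_mul {t i j m : ℕ} {p : Equiv.Perm ℕ} (ht : 1 ≤ t)
    (hp : ∀ m, t < m → p m = m) (hm : m ≤ t) :
    shiftCoord (t + 2) i j (Equiv.swap t (t + 1) * p) m = shiftCoord t i j p m := by
  have := lt_of_fixes (n := t + 1) (p := p) hp (m := m) (by omega)
  have e : (Equiv.swap t (t + 1) * p) m = t + 1 ∧ p m = t ∨
      (Equiv.swap t (t + 1) * p) m = p m ∧ p m ≠ t := by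
    rw [Equiv.Perm.mul_apply, Equiv.swap_apply_def]
    split_ifs <;> omega
  simp only [shiftCoord]
  split_ifs <;> omega

theorem altPerms_swapping_eq {t i j : ℕ} (hi : 1 ≤ i) (hij : i ≤ j) (hjt : j ≤ t) :
    {p ∈ altPerms (t + 2) i j | p (t + 1) = t} =
      (Equiv.swap t (t + 1) * ·) '' altPerms t i j := by
  have hsum : ∀ p : Equiv.Perm ℕ, (∀ m, t < m → p m = m) → ∀ k, k ≤ t →
      ∑ m ∈ Finset.range k, shiftCoord (t + 2) i j (Equiv.swap t (t + 1) * p) m =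
      ∑ m ∈ Finset.range k, shiftCoord t i j p m := fun p hp k hk =>
    Finset.sum_congr rfl fun m hm =>
      shiftCoord_swap_mul (by omega) hp (by have := Finset.mem_range.1 hm; omega)
  ext q
  constructor
  · rintro ⟨h, hq⟩
    have hl := apply_last_of_mem hi (by omega) (by omega) h
    have hqp : Equiv.swap t (t + 1) * (Equiv.swap t (t + 1) * q) = q := by
      rw [← mul_assoc, Equiv.swap_mul_self, one_mul]
    have hp : ∀ m, t < m → (Equiv.swap t (t + 1) * q) m = m := fun m hm => by
      rw [Equiv.Perm.mul_apply]
      rcases (Nat.succ_le_of_lt hm).eq_or_lt with rfl | h1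
      · rw [Nat.succ_eq_add_one, hq, Equiv.swap_apply_left]
      · have hqm : q m = m := by
          rcases (Nat.succ_le_of_lt h1).eq_or_lt with rfl | h2
          exacts [hl, h.1 m h2]
        rw [hqm, Equiv.swap_apply_of_ne_of_ne] <;> omega
    refine ⟨_, ⟨hp, fun k h1 h2 => ?_⟩, hqp⟩
    rw [← hsum _ hp k h2, hqp]
    exact h.2 k h1 (by omega)
  · rintro ⟨p, h, rfl⟩
    have ha : ∀ m, t + 1 < m → (Equiv.swap t (t + 1) * p) m = m := fun m hm => by
      rw [Equiv.Perm.mul_apply, h.1 m (by omega), Equiv.swap_apply_of_ne_of_ne] <;> omega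
    have hb : (Equiv.swap t (t + 1) * p) (t + 1) = t := by
      rw [Equiv.Perm.mul_apply, h.1 (t + 1) (by omega), Equiv.swap_apply_right]
    refine ⟨⟨fun m hm => ha m (by omega), fun k h1 h2 => ?_⟩, hb⟩
    rcases lt_trichotomy k (t + 1) with h3 | rfl | h3
    · rw [hsum p h.1 k (by omega)]
      exact h.2 k h1 (by omega)
    -- Here the sum is `t - (t + 1) + 1 = 0`; the `+ 1` is present because `t ≠ 0`.
    · rw [sum_shiftCoord ha hi (by omega) (by omega) (by omega), hb]
      split_ifs <;> omega
    · obtain rfl : k = t + 2 := by omega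
      rw [sum_shiftCoord (fun m hm => ha m (by omega)) hi (by omega) (by omega) le_rfl,
        ha (t + 2) (by omega)]
      simp

theorem altPerms_eq_union {t i j : ℕ} (hi : 1 ≤ i) (hij : i ≤ j) (hjt : j ≤ t) :
    altPerms (t + 2) i j =
      altPerms (t + 1) i j ∪ (Equiv.swap t (t + 1) * ·) '' altPerms t i j := by
  rw [← altPerms_fixing_eq hi hij (Nat.lt_succ_of_le hjt), ← altPerms_swapping_eq hi hij hjt]
  ext p
  constructor
  · intro h
    exact (apply_penultimate_of_mem hi hij hjt h).imp (⟨h, ·⟩) (⟨h, ·⟩)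
  · rintro (h | h) <;> exact h.1

theorem disjoint_altPerms {t i j : ℕ} (hi : 1 ≤ i) (hij : i ≤ j) (hjt : j ≤ t) :
    Disjoint (altPerms (t + 1) i j) ((Equiv.swap t (t + 1) * ·) '' altPerms t i j) := by
  rw [← altPerms_fixing_eq hi hij (Nat.lt_succ_of_le hjt), ← altPerms_swapping_eq hi hij hjt,
    Set.disjoint_left]
  rintro p ⟨-, h1⟩ ⟨-, h2⟩
  exact Nat.succ_ne_self t (h1.symm.trans h2)

/-! ### Coordinates of the roots and of `ρ` -/

theorem simpleRoot_apply (r : ℕ) (k : Fin r) (m : Fin (r + 1)) :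
    simpleRoot r k m =
      (if m.val = k.val then 1 else 0) - (if m.val = k.val + 1 then 1 else 0) := by
  simp [simpleRoot, Fin.ext_iff]

theorem rootSum_self {r a : ℕ} (ha : 1 ≤ a) (har : a ≤ r) :
    rootSum r a a = simpleRoot r ⟨a - 1, by omega⟩ := by
  rw [rootSum, Finset.sum_eq_single_of_mem ⟨a - 1, by omega⟩]
  · simp only [Finset.mem_filter, Finset.mem_univ, true_and]
    omega
  · intro k hk hne
    simp only [Finset.mem_filter, Finset.mem_univ, true_and] at hk
    exact absurd (Fin.ext (show k.val = a - 1 by omega)) hne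

theorem rootSum_succ {r a b : ℕ} (hab : a ≤ b + 1) (hb : b < r) :
    rootSum r a (b + 1) = rootSum r a b + simpleRoot r ⟨b, hb⟩ := by
  have h : (Finset.univ.filter fun k : Fin r => a ≤ k.val + 1 ∧ k.val + 1 ≤ b + 1) =
      insert ⟨b, hb⟩ (Finset.univ.filter fun k : Fin r => a ≤ k.val + 1 ∧ k.val + 1 ≤ b) := by
    ext k
    simp only [Finset.mem_insert, Finset.mem_filter, Finset.mem_univ, true_and, Fin.ext_iff]
    omega
  rw [rootSum, h, Finset.sum_insert (by simp), add_comm, rootSum]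

theorem rootSum_apply {r a b : ℕ} (ha : 1 ≤ a) (hab : a ≤ b) (hb : b ≤ r) (m : Fin (r + 1)) :
    rootSum r a b m =
      (if m.val + 1 = a then 1 else 0) - (if m.val = b then 1 else 0) := by
  induction b, hab using Nat.le_induction with
  | base =>
    obtain ⟨c, rfl⟩ : ∃ c, a = c + 1 := ⟨a - 1, by omega⟩
    simp [rootSum_self ha hb, simpleRoot_apply]
  | succ b hab ih =>
    rw [rootSum_succ (by omega) hb, PiLp.add_apply, ih (by omega), simpleRoot_apply]
    ring

theorem highestRoot_apply {r : ℕ} (hr : 1 ≤ r) (m : Fin (r + 1)) :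
    highestRoot r m = (if m.val = 0 then 1 else 0) - (if m.val = r then 1 else 0) := by
  have h : highestRoot r = rootSum r 1 r := by
    rw [highestRoot, rootSum, Finset.filter_true_of_mem]
    intro k _
    omega
  simp [h, rootSum_apply le_rfl hr le_rfl]

theorem mem_posRoots {r : ℕ} {β : Space r} :
    β ∈ posRoots r ↔ ∃ a b, 1 ≤ a ∧ a ≤ b ∧ b ≤ r ∧ rootSum r a b = β := by
  simp only [posRoots, Finset.mem_image, Finset.mem_filter, Finset.mem_product, Finset.mem_Icc,
    Prod.exists]
  constructor
  · rintro ⟨a, b, ⟨⟨⟨h1, -⟩, -, h2⟩, h3⟩, h⟩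
    exact ⟨a, b, h1, h3, h2, h⟩
  · rintro ⟨a, b, h1, h3, h2, h⟩
    exact ⟨a, b, ⟨⟨⟨h1, h3.trans h2⟩, h1.trans h3, h2⟩, h3⟩, h⟩

theorem rootSum_injective {r a b a' b' : ℕ} (ha : 1 ≤ a) (hab : a ≤ b) (hb : b ≤ r)
    (ha' : 1 ≤ a') (hab' : a' ≤ b') (hb' : b' ≤ r) (h : rootSum r a b = rootSum r a' b') :
    a = a' ∧ b = b' := by
  have key : ∀ m : Fin (r + 1), rootSum r a b m = rootSum r a' b' m := fun m => by rw [h]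
  -- These are the positions of the entries `1` and `-1` of the first root.
  have h1 := key ⟨a - 1, by omega⟩
  have h2 := key ⟨b, by omega⟩
  rw [rootSum_apply ha hab hb, rootSum_apply ha' hab' hb'] at h1 h2
  constructor
  · by_contra hne
    rw [if_pos (by simp only; omega), if_neg (by simp only; omega),
      if_neg (by simp only; omega)] at h1
    split_ifs at h1 <;> norm_num at h1
  · by_contra hne
    rw [if_neg (by simp only; omega), if_pos rfl, if_neg (c := _ = b') hne] at h2
    split_ifs at h2 <;> norm_num at h2

/-- Coordinate `m` is `1` in the `r - m` roots `α_{m+1,b}` and `-1` in the `m` roots `α_{a,m}`. -/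
theorem rho_apply (r : ℕ) (m : Fin (r + 1)) : rho r m = (r : ℝ) / 2 - m.val := by
  classical
  have hm := m.isLt
  have h : ∑ β ∈ posRoots r, β m = ∑ a ∈ Finset.Icc 1 r, ∑ b ∈ Finset.Icc 1 r,
      ((if a = m.val + 1 then (if m.val + 1 ≤ b then (1 : ℝ) else 0) else 0) -
        if b = m.val then (if a ≤ m.val then (1 : ℝ) else 0) else 0) := by
    rw [posRoots, Finset.sum_image, Finset.sum_filter, Finset.sum_product]
    · refine Finset.sum_congr rfl fun a ha => Finset.sum_congr rfl fun b hb => ?_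
      rw [Finset.mem_Icc] at ha hb
      by_cases hab : a ≤ b
      · rw [if_pos hab, rootSum_apply ha.1 hab hb.2]
        split_ifs <;> first | omega | rfl
      · rw [if_neg hab]
        split_ifs <;> first | omega | simp
    · rintro ⟨a, b⟩ h1 ⟨a', b'⟩ h2 h
      simp only [Finset.coe_filter, Finset.mem_product, Finset.mem_Icc, Set.mem_ofPred_eq] at h1 h2
      have := rootSum_injective h1.1.1.1 h1.2 h1.1.2.2 h2.1.1.1 h2.2 h2.1.2.2 h
      exact Prod.ext this.1 this.2
  have h1 : ∑ b ∈ Finset.Icc 1 r, (if m.val + 1 ≤ b then (1 : ℝ) else 0) = r - m.val := by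
    rw [Finset.sum_boole]
    have : (Finset.Icc 1 r).filter (fun b => m.val + 1 ≤ b) = Finset.Icc (m.val + 1) r := by
      ext b
      simp only [Finset.mem_filter, Finset.mem_Icc]
      omega
    rw [this, Nat.card_Icc, Nat.add_sub_add_right, Nat.cast_sub (by omega)]
  have h2 : ∑ a ∈ Finset.Icc 1 r, (if a ≤ m.val then (1 : ℝ) else 0) = m.val := by
    rw [Finset.sum_boole]
    have : (Finset.Icc 1 r).filter (fun b => b ≤ m.val) = Finset.Icc 1 m.val := by
      ext b
      simp only [Finset.mem_filter, Finset.mem_Icc]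
      omega
    rw [this, Nat.card_Icc, Nat.add_sub_cancel]
  have h3 : ∑ a ∈ Finset.Icc 1 r, ∑ b ∈ Finset.Icc 1 r,
      (if a = m.val + 1 then (if m.val + 1 ≤ b then (1 : ℝ) else 0) else 0) = r - m.val := by
    rw [Finset.sum_comm, ← h1]
    refine Finset.sum_congr rfl fun b hb => ?_
    rw [Finset.mem_Icc] at hb
    rw [Finset.sum_ite_eq']
    simp only [Finset.mem_Icc]
    split_ifs <;> first | omega | rfl
  have h4 : ∑ a ∈ Finset.Icc 1 r, ∑ b ∈ Finset.Icc 1 r,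
      (if b = m.val then (if a ≤ m.val then (1 : ℝ) else 0) else 0) = m.val := by
    refine Eq.trans (Finset.sum_congr rfl fun a ha => ?_) h2
    rw [Finset.mem_Icc] at ha
    rw [Finset.sum_ite_eq']
    simp only [Finset.mem_Icc]
    split_ifs <;> first | omega | rfl
  rw [rho, PiLp.smul_apply, WithLp.ofLp_sum, Finset.sum_apply, h]
  simp only [Finset.sum_sub_distrib, h3, h4, smul_eq_mul]
  ring

/-! ### Positivity of Kostant's partition function -/

theorem kostant_pos_iff {r : ℕ} {ξ : Space r} :
    0 < kostant r ξ ↔ ξ ∈ Submodule.span ℕ (posRoots r : Set (Space r)) := by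
  rw [kostant, Set.ncard_pos (vectorPartitions_finite r ξ), Submodule.mem_span_finset']
  rfl

/-- The `1` of a positive root precedes its `-1`, so each of its partial sums is `0` or `1`. -/
theorem sum_coord_nonneg_of_mem_span {r k : ℕ} (hk : k ≤ r + 1) {ξ : Space r}
    (hξ : ξ ∈ Submodule.span ℕ (posRoots r : Set (Space r))) :
    0 ≤ ∑ m : Fin k, ξ (Fin.castLE hk m) := by
  induction hξ using Submodule.span_induction with
  | mem β hβ =>
    obtain ⟨a, b, ha, hab, hb, rfl⟩ := mem_posRoots.1 hβ
    simp only [rootSum_apply ha hab hb, Fin.val_castLE]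
    rw [← Finset.sum_range fun m => (if m + 1 = a then (1 : ℝ) else 0) - if m = b then 1 else 0,
      Finset.sum_sub_distrib, sum_range_ite_succ ha, sum_range_ite]
    split_ifs <;> first | omega | norm_num
  | zero => simp
  | add x y _ _ hx hy =>
    simp only [PiLp.add_apply, Finset.sum_add_distrib]
    exact add_nonneg hx hy
  | smul c x _ hx =>
    simp only [PiLp.smul_apply, ← Finset.smul_sum]
    exact nsmul_nonneg hx c

/-- Summation by parts: the partial sums are the coefficients on the simple roots, so these roots
alone suffice. -/
theorem mem_span_of_sum_nonneg {r : ℕ} {ξ : Space r} {x : ℕ → ℤ}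
    (hx : ∀ m : Fin (r + 1), ξ m = x m.val) (h0 : ∑ m ∈ Finset.range (r + 1), x m = 0)
    (h : ∀ k, 1 ≤ k → k ≤ r → 0 ≤ ∑ m ∈ Finset.range k, x m) :
    ξ ∈ Submodule.span ℕ (posRoots r : Set (Space r)) := by
  set C : ℕ → ℤ := fun k => ∑ m ∈ Finset.range k, x m with hC
  have hCx : ∀ m, C (m + 1) = C m + x m := fun m => Finset.sum_range_succ x m
  have hξ : ξ = ∑ k : Fin r, (C (k.val + 1)).toNat • simpleRoot r k := by
    ext m
    have h1 : ∀ k : Fin r, ((C (k.val + 1)).toNat • simpleRoot r k) m =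
        (C (k.val + 1) : ℝ) *
          ((if m.val = k.val then 1 else 0) - (if m.val = k.val + 1 then 1 else 0)) := fun k => by
      rw [PiLp.smul_apply, simpleRoot_apply, nsmul_eq_mul]
      congr 1
      exact_mod_cast Int.toNat_of_nonneg (h _ (by omega) (by omega))
    rw [WithLp.ofLp_sum, Finset.sum_apply, Finset.sum_congr rfl fun k _ => h1 k, hx,
      ← Finset.sum_range fun k => (C (k + 1) : ℝ) *
          ((if m.val = k then 1 else 0) - (if m.val = k + 1 then 1 else 0))]
    simp only [mul_sub, mul_ite, mul_one, mul_zero, Finset.sum_sub_distrib]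
    rw [Finset.sum_ite_eq]
    -- No simple root starts at the last coordinate; the missing term is the total sum, which
    -- vanishes.
    have hlast : (if m.val ∈ Finset.range r then (C (m.val + 1) : ℝ) else 0) = C (m.val + 1) := by
      split_ifs with hm
      · rfl
      · have : m.val = r := by rw [Finset.mem_range] at hm; omega
        rw [this, show C (r + 1) = 0 from h0, Int.cast_zero]
    rw [hlast, hCx, Int.cast_add]
    obtain ⟨m, hm⟩ := m
    cases m with
    | zero => simp [hC]
    | succ m =>
      simp only [Nat.add_right_cancel_iff]
      rw [Finset.sum_ite_eq, if_pos (by rw [Finset.mem_range]; omega)]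
      ring
  rw [hξ]
  refine Submodule.sum_mem _ fun k _ => Submodule.smul_mem _ _ (Submodule.subset_span ?_)
  exact mem_posRoots.2 ⟨k.val + 1, k.val + 1, by omega, le_rfl, k.isLt,
    rootSum_self (by omega) k.isLt⟩

theorem kostant_pos_iff_sum_nonneg {r : ℕ} {ξ : Space r} {x : ℕ → ℤ}
    (hx : ∀ m : Fin (r + 1), ξ m = x m.val) (h0 : ∑ m ∈ Finset.range (r + 1), x m = 0) :
    0 < kostant r ξ ↔ ∀ k, 1 ≤ k → k ≤ r → 0 ≤ ∑ m ∈ Finset.range k, x m := by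
  rw [kostant_pos_iff]
  refine ⟨fun h k _ hk => ?_, mem_span_of_sum_nonneg hx h0⟩
  have := sum_coord_nonneg_of_mem_span (k := k) (by omega) h
  simp only [hx, Fin.val_castLE] at this
  rw [← Finset.sum_range fun m => (x m : ℝ)] at this
  exact_mod_cast this

/-! ### The Weyl group as permutations, and transfer to `altPerms` -/

theorem exists_mem_weylGroup_of_perm (r : ℕ) (p : Equiv.Perm (Fin (r + 1))) :
    ∃ σ ∈ weylGroup r, ∀ (v : Space r) (m : Fin (r + 1)), σ v m = v (p m) := by
  have hp : p ∈ Submonoid.closure (Set.range fun k : Fin r => Equiv.swap k.castSucc k.succ) := by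
    rw [Equiv.Perm.mclosure_swap_castSucc_succ]
    trivial
  induction hp using Submonoid.closure_induction with
  | mem x hx =>
    obtain ⟨k, rfl⟩ := hx
    exact ⟨_, Subgroup.subset_closure ⟨k, rfl⟩, simpleReflection_apply r k⟩
  | one => exact ⟨1, one_mem _, fun _ _ => rfl⟩
  | mul x y _ _ hx hy =>
    obtain ⟨σ, hσ, h1⟩ := hx
    obtain ⟨τ, hτ, h2⟩ := hy
    -- Acting on coordinates by precomposition reverses products.
    exact ⟨τ * σ, mul_mem hτ hσ, fun v m => by
      rw [LinearIsometryEquiv.coe_mul, Function.comp_apply, h2, h1, Equiv.Perm.mul_apply]⟩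

theorem perm_eq_of_forall_apply_eq {r : ℕ} {p q : Equiv.Perm (Fin (r + 1))}
    (h : ∀ (v : Space r) (m : Fin (r + 1)), v (p m) = v (q m)) : p = q := by
  ext m
  have := h (EuclideanSpace.single (p m) 1) m
  by_contra hne
  simp [Fin.ext_iff, Ne.symm hne] at this

/-- The extension of a permutation of `{0, …, r}` to `ℕ` by the identity. -/
def extendPerm {r : ℕ} (p : Equiv.Perm (Fin (r + 1))) : Equiv.Perm ℕ :=
  p.extendDomain Fin.equivSubtype

theorem extendPerm_val {r : ℕ} (p : Equiv.Perm (Fin (r + 1))) (m : Fin (r + 1)) :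
    extendPerm p m.val = (p m).val :=
  Equiv.Perm.extendDomain_apply_image p Fin.equivSubtype m

theorem extendPerm_of_lt {r : ℕ} (p : Equiv.Perm (Fin (r + 1))) {m : ℕ} (hm : r < m) :
    extendPerm p m = m :=
  Equiv.Perm.extendDomain_apply_not_subtype p Fin.equivSubtype (by omega)

theorem extendPerm_injective (r : ℕ) : Function.Injective (extendPerm (r := r)) := fun p q h => by
  ext m
  rw [← extendPerm_val, h, extendPerm_val]

theorem exists_extendPerm_eq {r : ℕ} {q : Equiv.Perm ℕ} (hq : ∀ m, r < m → q m = m) :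
    ∃ p : Equiv.Perm (Fin (r + 1)), extendPerm p = q := by
  let f : Fin (r + 1) → Fin (r + 1) := fun m =>
    ⟨q m.val, lt_of_fixes (fun m hm => hq m (by omega)) m.isLt⟩
  have hf : Function.Injective f := fun a b h =>
    Fin.ext (q.injective (Fin.ext_iff.1 h))
  refine ⟨Equiv.ofBijective f (Finite.injective_iff_bijective.1 hf), Equiv.ext fun m => ?_⟩
  rcases Nat.lt_or_ge r m with hm | hm
  · rw [extendPerm_of_lt _ hm, hq m hm]
  · exact extendPerm_val _ ⟨m, by omega⟩

theorem mem_alternationSet_iff {r i j : ℕ} (hi : 1 ≤ i) (hij : i ≤ j) (hjr : j ≤ r)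
    {σ : weylGroup r} {p : Equiv.Perm (Fin (r + 1))}
    (hp : ∀ (v : Space r) (m : Fin (r + 1)), (σ : Space r ≃ₗᵢ[ℝ] Space r) v m = v (p m)) :
    σ ∈ alternationSet r (highestRoot r) (-rootSum r i j) ↔ extendPerm p ∈ altPerms r i j := by
  have h0 : ∑ m ∈ Finset.range (r + 1), shiftCoord r i j (extendPerm p) m = 0 := by
    have key := sum_range_apply (n := r + 1) (p := extendPerm p)
      fun m hm => extendPerm_of_lt p (by omega)
    simp only [shiftCoord, Finset.sum_add_distrib, Finset.sum_sub_distrib, sum_range_ite,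
      sum_range_ite_succ hi, key (fun m => (m : ℤ)), key (fun m => if m = 0 then 1 else 0),
      key (fun m => if m = r then 1 else 0)]
    split_ifs <;> omega
  rw [alternationSet, Set.mem_ofPred_eq, kostant_pos_iff_sum_nonneg
    (x := shiftCoord r i j (extendPerm p)) (fun m => ?_) h0]
  · exact ⟨fun h => ⟨fun m hm => extendPerm_of_lt p hm, h⟩, fun h => h.2⟩
  · simp only [PiLp.sub_apply, PiLp.neg_apply, hp, PiLp.add_apply, rho_apply,
      highestRoot_apply (hi.trans (hij.trans hjr)), rootSum_apply hi hij hjr, shiftCoord,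
      extendPerm_val]
    push_cast
    ring

theorem ncard_alternationSet {r i j : ℕ} (hi : 1 ≤ i) (hij : i ≤ j) (hjr : j ≤ r) :
    (alternationSet r (highestRoot r) (-rootSum r i j)).ncard = (altPerms r i j).ncard := by
  choose P hP using fun σ : weylGroup r => exists_perm_of_mem_weylGroup r σ.2
  have hinj : Function.Injective fun σ => extendPerm (P σ) := fun σ τ h => by
    refine Subtype.ext (LinearIsometryEquiv.ext fun v => ?_)
    ext m
    rw [hP, hP, extendPerm_injective r h]
  have hset : alternationSet r (highestRoot r) (-rootSum r i j) =
      (fun σ => extendPerm (P σ)) ⁻¹' altPerms r i j :=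
    Set.ext fun σ => mem_alternationSet_iff hi hij hjr (hP σ)
  -- It remains to see that every element of `altPerms` comes from the Weyl group, which holds
  -- because adjacent transpositions generate all permutations.
  rw [hset, Set.ncard_preimage_of_injective_subset_range hinj]
  intro q hq
  obtain ⟨p, rfl⟩ := exists_extendPerm_eq hq.1
  obtain ⟨σ, hσ, h⟩ := exists_mem_weylGroup_of_perm r p
  refine ⟨⟨σ, hσ⟩, ?_⟩
  show extendPerm (P ⟨σ, hσ⟩) = extendPerm p
  rw [perm_eq_of_forall_apply_eq fun v m => (hP ⟨σ, hσ⟩ v m).symm.trans (h v m)]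

theorem finite_altPerms (r i j : ℕ) : (altPerms r i j).Finite :=
  (Set.finite_range (extendPerm (r := r))).subset fun _ hq => exists_extendPerm_eq hq.1

end TypeA

theorem mainTheorem7 (r i j : ℕ) (hr : 3 ≤ r) (hi : 1 ≤ i) (hij : i ≤ j) (hj : j ≤ r - 2) :
    (TypeA.alternationSet r (TypeA.highestRoot r) (-TypeA.rootSum r i j)).ncard =
      (TypeA.alternationSet (r - 1) (TypeA.highestRoot (r - 1))
          (-TypeA.rootSum (r - 1) i j)).ncard +
        (TypeA.alternationSet (r - 2) (TypeA.highestRoot (r - 2))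
          (-TypeA.rootSum (r - 2) i j)).ncard := by
  obtain ⟨t, rfl⟩ : ∃ t, r = t + 2 := ⟨r - 2, by omega⟩
  rw [Nat.add_sub_cancel] at hj
  change _ = (TypeA.alternationSet (t + 1) (TypeA.highestRoot (t + 1))
      (-TypeA.rootSum (t + 1) i j)).ncard +
    (TypeA.alternationSet t (TypeA.highestRoot t) (-TypeA.rootSum t i j)).ncard
  rw [TypeA.ncard_alternationSet hi hij (by omega), TypeA.ncard_alternationSet hi hij (by omega),
    TypeA.ncard_alternationSet hi hij hj, TypeA.altPerms_eq_union hi hij hj,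
    Set.ncard_union_eq (TypeA.disjoint_altPerms hi hij hj) (TypeA.finite_altPerms _ _ _)
      ((TypeA.finite_altPerms _ _ _).image _),
    Set.ncard_image_of_injective _ (mul_right_injective _)]
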